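/- Let $M$ be a matroid of rank $k$ on a finite ground set $E$ with $|E|=n$, and let $M^*$ be its dual. Call a matroid \emph{paving} if each of its circuits has size equal to its rank or its rank plus one, and \emph{sparse paving} if both it and its dual are paving. For $1\le r\le n-k$ let $d_r(M)$ be the $r$-th generalized Hamming weight of $M$, that is, the minimum size of a circuit of the matroid on $E$ whose independent sets are the sets $A\subseteq E$ with $|A|-\mathrm{rk}_M(A)\le r-1$; put $d_0(M)=0$. Let $\mathbb L$ be a field, let $I_{\Delta(M)}\subseteq\mathbb L[x_e : e\in E]$ be the Stanley--Reisner ideal of the independence complex $\Delta(M)$ of $M$, and let $I_{\Delta(M)}^{(s)}$ be its $s$-th symbolic power. For a homogeneous ideal $J$ write $\alpha(J)$ for the least degree of a nonzero homogeneous element of $J$, and $\widehat\alpha(I)=\lim_{s\to\infty}\alpha(I^{(s)})/s$ for the Waldschmidt constant. Suppose that one of the following holds: (a) $M$ is sparse paving and $2\le k\le n-2$; or (b) $k\le n-2$, the dual $M^*$ is paving, and $d_1(M)\ge\frac{k+2}{2}$. Then the sequence $\{d_i(M)\}_{i=1}^{n-k}$ is extended subadditive, i.e. with $D=n-k$ and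 $d_i=d_i(M)$, one has $d_{i+j}\le d_i+d_j$ for all $i,j\ge 1$ with $i+j\le D$, and $d_r+d_D\le d_t+d_{D+r-t}$ for all $1\le r<t\le D$. Moreover, for every $s=(n-k)q+r$ with $q\in\mathbb N$ and $0\le r<n-k$, $$\alpha\bigl(I_{\Delta(M)}^{(s)}\bigr)=q\,d_{n-k}(M)+d_r(M)=nq+d_r(M).$$ In particular, the limit defining $\widehat\alpha(I_{\Delta(M)})$ exists and $$\widehat\alpha(I_{\Delta(M)})=\frac{d_{n-k}(M)}{n-k}=\frac{n}{n-k}.$$ -/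

import Mathlib

open Filter Topology

namespace Matroid

variable {α : Type*}

/-- The elongation of a finite matroid `M` by rank `r`: the matroid on the same ground set whose
independent sets are the sets `A ⊆ M.E` of nullity `|A| - rk A` at most `r`. -/
def elongation (M : Matroid α) [M.Finite] (r : ℕ) : Matroid α :=
  (IndepMatroid.ofFinite (E := M.E) M.ground_finite
    (fun A => A ⊆ M.E ∧ A.encard ≤ M.eRk A + r)
    ⟨Set.empty_subset _, by simp⟩
    (by
      rintro I J ⟨hJE, hJ⟩ hIJ
      refine ⟨hIJ.trans hJE, ?_⟩
      have hfin : (J \ I).encard ≠ ⊤ :=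
        Set.encard_ne_top_iff.2 ((M.ground_finite.subset hJE).subset Set.sdiff_subset)
      have h1 : M.eRk J ≤ M.eRk I + (J \ I).encard :=
        (M.eRk_le_eRk_add_eRk_sdiff hIJ).trans (by gcongr; exact M.eRk_le_encard _)
      have h2 : (J \ I).encard + I.encard = J.encard := Set.encard_sdiff_add_encard_of_subset hIJ
      refine (ENat.add_le_add_iff_left hfin).1 ?_
      calc (J \ I).encard + I.encard = J.encard := h2
        _ ≤ M.eRk J + r := hJ
        _ ≤ M.eRk I + (J \ I).encard + r := by gcongr
        _ = (J \ I).encard + (M.eRk I + r) := by ring)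
    (by
      rintro I J ⟨hIE, hI⟩ ⟨hJE, hJ⟩ hlt
      have hIfin := M.ground_finite.subset hIE
      have hJfin := M.ground_finite.subset hJE
      have hlt' : I.encard < J.encard := by
        rw [← hIfin.cast_ncard_eq, ← hJfin.cast_ncard_eq]; exact_mod_cast hlt
      by_cases hlt2 : M.eRk I < M.eRk J
      · obtain ⟨e, he, hrk⟩ := M.exists_eRk_insert_eq_add_one_of_lt hlt2
        refine ⟨e, he.1, he.2, Set.insert_subset (hJE he.1) hIE, ?_⟩
        rw [Set.encard_insert_of_notMem he.2, hrk, add_right_comm]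
        gcongr
      · obtain ⟨e, heJ, heI⟩ : ∃ e ∈ J, e ∉ I := by
          by_contra! h
          exact hlt'.not_ge (Set.encard_le_encard h)
        refine ⟨e, heJ, heI, Set.insert_subset (hJE heJ) hIE, ?_⟩
        rw [Set.encard_insert_of_notMem heI]
        calc I.encard + 1 ≤ J.encard := Order.add_one_le_of_lt hlt'
          _ ≤ M.eRk J + r := hJ
          _ ≤ M.eRk I + r := by gcongr; exact not_lt.1 hlt2
          _ ≤ M.eRk (insert e I) + r := by gcongr; exact M.eRk_mono (Set.subset_insert _ _))
    (fun _ h => h.1)).matroid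

theorem elongation_indep_iff (M : Matroid α) [M.Finite] (r : ℕ) (A : Set α) :
    (M.elongation r).Indep A ↔ A ⊆ M.E ∧ A.encard ≤ M.eRk A + r := Iff.rfl

theorem elongation_ground (M : Matroid α) [M.Finite] (r : ℕ) : (M.elongation r).E = M.E := rfl

/-- The `r`-th generalized Hamming weight of `M`, for `1 ≤ r ≤ rk M✶`: the minimum size of a
circuit of the elongation of `M` by rank `r - 1`. By convention the weight of index `0` is `0`. -/
noncomputable def hammingWeight (M : Matroid α) [M.Finite] : ℕ → ℕ
  | 0 => 0
  | r + 1 => sInf {m : ℕ | ∃ C : Set α, (M.elongation r).IsCircuit C ∧ C.ncard = m}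

/-- A matroid is paving if every circuit has size equal to the rank or to the rank plus one. -/
def IsPaving (M : Matroid α) : Prop :=
  ∀ C : Set α, M.IsCircuit C → C.encard = M.eRank ∨ C.encard = M.eRank + 1

/-- A matroid is sparse paving if it and its dual are paving. -/
def IsSparsePaving (M : Matroid α) : Prop := M.IsPaving ∧ M✶.IsPaving

/-- The independence complex `Δ(M)`, as the set of its faces. -/
def independenceComplex (M : Matroid α) : Set (Finset M.E) :=
  {F | M.Indep ((fun e : M.E => (e : α)) '' (F : Set M.E))}

end Matroid

/-- A finite sequence `d 1, …, d D` is subadditive. -/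
def FiniteSubadditive (d : ℕ → ℕ) (D : ℕ) : Prop :=
  ∀ i j : ℕ, 1 ≤ i → 1 ≤ j → i + j ≤ D → d (i + j) ≤ d i + d j

/-- A finite sequence `d 1, …, d D` is extended subadditive. -/
def ExtendedSubadditive (d : ℕ → ℕ) (D : ℕ) : Prop :=
  FiniteSubadditive d D ∧
    ∀ r t : ℕ, 1 ≤ r → r < t → t ≤ D → d r + d D ≤ d t + d (D + r - t)

/-- The Stanley-Reisner ideal of a simplicial complex given by its set of faces `Δ`: it is
generated by the squarefree monomials `∏ v ∈ F, X v` over the non-faces `F`. -/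
noncomputable def stanleyReisnerIdeal {σ : Type*} (𝕃 : Type*) [Field 𝕃] (Δ : Set (Finset σ)) :
    Ideal (MvPolynomial σ 𝕃) :=
  Ideal.span {p | ∃ F : Finset σ, F ∉ Δ ∧ p = ∏ v ∈ F, MvPolynomial.X v}

/-- The `s`-th symbolic power of an ideal `I` of a Noetherian ring `R`: the intersection over the
associated primes `P` of `I` of the contractions to `R` of the ideals `I ^ s R_P`. -/
noncomputable def symbolicPower {R : Type*} [CommRing R] (I : Ideal R) (s : ℕ) : Ideal R :=
  ⨅ (P : Ideal R) (hP : IsAssociatedPrime P (R ⧸ I)),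
    haveI : P.IsPrime := hP.isPrime
    ((I ^ s).map (algebraMap R (Localization.AtPrime P))).comap
      (algebraMap R (Localization.AtPrime P))

/-- The initial degree of a homogeneous ideal: the smallest degree in which it has a nonzero
homogeneous element. -/
noncomputable def initialDegree {σ 𝕃 : Type*} [Field 𝕃] (J : Ideal (MvPolynomial σ 𝕃)) : ℕ :=
  sInf {m : ℕ | ∃ f ∈ J, f ≠ 0 ∧ f.IsHomogeneous m}

/-- The Waldschmidt constant of a homogeneous ideal: the limit of `α(I^(s)) / s`. -/
noncomputable def waldschmidtConstant {σ 𝕃 : Type*} [Field 𝕃]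
    (I : Ideal (MvPolynomial σ 𝕃)) : ℝ :=
  limUnder atTop (fun s : ℕ => (initialDegree (symbolicPower I s) : ℝ) / (s : ℝ))

/-! The symbolic power of $I_{\Delta(M)}$ is a monomial ideal: $x^m$ lies in it exactly when $m$ has
total at least $s$ outside every base (`mem_symbolicPower_stanleyReisnerIdeal_iff`). So $\alpha$ is
the minimum of $|m|$ under these constraints.

For the lower bound, write $m$ as a sum of indicators of nested level sets $A_j$, and choose one
base $B$ meeting every $A_j$ in a basis of $A_j$. The total of $m$ outside $B$ is then the sum of
the nullities $i_j$ of the $A_j$, while $|A_j|\ge d_{i_j}$. Extended subadditivity turns $\sum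
d_{i_j}$ into at least $d_D\lfloor s/D\rfloor+d_{s\bmod D}$ (`ExtendedSubadditive.quotient_sum_le`).
The bound is attained by $q\mathbf 1_E+\mathbf 1_A$, with $A$ a smallest set of nullity at least
$r$.

If $M^*$ is paving, every set of more than $k$ elements spans, so $d_i=k+i$ for $i\ge2$ and only
$d_1$ is free. Extended subadditivity then reduces to $2d_1\ge k+2$. -/

namespace MvPolynomial

/-! ### Ideals defined by a weighted order. -/

variable {σ 𝕃 : Type*} [Field 𝕃]

/-- The ideal of polynomials all of whose monomials have weight at least `s`. -/
noncomputable def weightIdeal (𝕃 : Type*) [Field 𝕃] (w : σ → ℕ) (s : ℕ) :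
    Ideal (MvPolynomial σ 𝕃) where
  carrier := {f | (s : ℕ∞) ≤ (f : MvPowerSeries σ 𝕃).weightedOrder w}
  add_mem' := by
    intro f g hf hg
    simp only [Set.mem_ofPred_eq, coe_add] at *
    exact (le_min hf hg).trans (MvPowerSeries.min_weightedOrder_le_add w)
  zero_mem' := by simp
  smul_mem' := by
    intro c f hf
    simp only [Set.mem_ofPred_eq, smul_eq_mul, coe_mul, MvPowerSeries.weightedOrder_mul] at *
    exact hf.trans le_add_self

theorem mem_weightIdeal_iff {w : σ → ℕ} {s : ℕ} {f : MvPolynomial σ 𝕃} :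
    f ∈ weightIdeal 𝕃 w s ↔ (s : ℕ∞) ≤ (f : MvPowerSeries σ 𝕃).weightedOrder w := Iff.rfl

theorem mem_weightIdeal_iff_forall_support {w : σ → ℕ} {s : ℕ} {f : MvPolynomial σ 𝕃} :
    f ∈ weightIdeal 𝕃 w s ↔ ∀ m ∈ f.support, s ≤ Finsupp.weight w m := by
  rw [mem_weightIdeal_iff]
  constructor
  · intro h m hm
    have := h.trans (MvPowerSeries.weightedOrder_le w (d := m)
      (by simpa using mem_support_iff.1 hm))
    exact_mod_cast this
  · intro h
    refine MvPowerSeries.nat_le_weightedOrder w fun d hd => ?_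
    by_contra hne
    exact hd.not_ge (h d (mem_support_iff.2 (by simpa using hne)))

theorem weightIdeal_mul_le (w : σ → ℕ) (s t : ℕ) :
    weightIdeal 𝕃 w s * weightIdeal 𝕃 w t ≤ weightIdeal 𝕃 w (s + t) := by
  refine Ideal.mul_le.2 fun f hf g hg => ?_
  rw [mem_weightIdeal_iff] at *
  rw [coe_mul, MvPowerSeries.weightedOrder_mul, Nat.cast_add]
  exact add_le_add hf hg

theorem weightIdeal_one_pow_le (w : σ → ℕ) (s : ℕ) :
    weightIdeal 𝕃 w 1 ^ s ≤ weightIdeal 𝕃 w s := by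
  induction s with
  | zero => intro f _; simp [mem_weightIdeal_iff]
  | succ s ih =>
    rw [pow_succ]
    exact (Ideal.mul_mono_left ih).trans (weightIdeal_mul_le w s 1)

/-- Weighted orders add under products, so a factor of order zero cancels. This gives primality for
`s = 1` and later removes the denominators of the localizations. -/
theorem mem_weightIdeal_of_mul_mem {w : σ → ℕ} {s : ℕ} {u f : MvPolynomial σ 𝕃}
    (hu : u ∉ weightIdeal 𝕃 w 1) (h : u * f ∈ weightIdeal 𝕃 w s) : f ∈ weightIdeal 𝕃 w s := by
  rw [mem_weightIdeal_iff] at *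
  rw [Nat.cast_one, Order.one_le_iff_ne_zero, not_not] at hu
  rwa [coe_mul, MvPowerSeries.weightedOrder_mul, hu, zero_add] at h

theorem weightIdeal_one_isPrime (w : σ → ℕ) : (weightIdeal 𝕃 w 1).IsPrime where
  ne_top' := by
    rw [Ideal.ne_top_iff_one, mem_weightIdeal_iff]
    simp
  mem_or_mem' := by
    intro f g h
    by_contra! hc
    exact hc.2 (mem_weightIdeal_of_mul_mem hc.1 h)

end MvPolynomial

open MvPolynomial

/-! ### Stanley-Reisner ideals and their symbolic powers. -/

section StanleyReisner

variable {σ 𝕃 : Type*} [Field 𝕃] {Δ : Set (Finset σ)}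

open Classical in
/-- The weight which counts the degree in the variables outside `G`. -/
noncomputable def outsideWeight (G : Finset σ) (v : σ) : ℕ := if v ∈ G then 0 else 1

theorem weight_outsideWeight_eq_zero_iff {G : Finset σ} {m : σ →₀ ℕ} :
    Finsupp.weight (outsideWeight G) m = 0 ↔ m.support ⊆ G := by
  classical
  rw [Finsupp.weight_apply, Finsupp.sum, Finset.sum_eq_zero_iff]
  refine forall₂_congr fun v hv => ?_
  have := Finsupp.mem_support_iff.1 hv
  simp [outsideWeight, this]

theorem prod_X_notMem_weightIdeal (G : Finset σ) :
    ∏ v ∈ G, (X v : MvPolynomial σ 𝕃) ∉ weightIdeal 𝕃 (outsideWeight G) 1 := by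
  have := weightIdeal_one_isPrime (𝕃 := 𝕃) (outsideWeight G)
  rw [Ideal.IsPrime.prod_mem_iff]
  rintro ⟨v, hv, h⟩
  rw [mem_weightIdeal_iff_forall_support] at h
  have := h (Finsupp.single v 1) (by simp [support_X])
  simp [Finsupp.weight_single, outsideWeight, hv] at this

theorem X_mem_weightIdeal {G : Finset σ} {v : σ} (hv : v ∉ G) :
    (X v : MvPolynomial σ 𝕃) ∈ weightIdeal 𝕃 (outsideWeight G) 1 := by
  rw [mem_weightIdeal_iff_forall_support]
  intro m hm
  rw [support_X, Finset.mem_singleton] at hm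
  simp [hm, Finsupp.weight_single, outsideWeight, hv]

theorem prod_X_mem_stanleyReisnerIdeal {F : Finset σ} (hF : F ∉ Δ) :
    ∏ v ∈ F, X v ∈ stanleyReisnerIdeal 𝕃 Δ :=
  Ideal.subset_span ⟨F, hF, rfl⟩

theorem stanleyReisnerIdeal_le_weightIdeal (hΔ : IsLowerSet Δ) {G : Finset σ} (hG : G ∈ Δ) :
    stanleyReisnerIdeal 𝕃 Δ ≤ weightIdeal 𝕃 (outsideWeight G) 1 := by
  refine Ideal.span_le.2 ?_
  rintro _ ⟨F, hF, rfl⟩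
  have := weightIdeal_one_isPrime (𝕃 := 𝕃) (outsideWeight G)
  obtain ⟨v, hvF, hvG⟩ : ∃ v ∈ F, v ∉ G := by
    by_contra! h
    exact hF (hΔ h hG)
  refine (Ideal.IsPrime.prod_mem_iff).2 ⟨v, hvF, X_mem_weightIdeal hvG⟩

variable [Finite σ]

/-- Half of the decomposition into facet primes: a monomial supported on a face has weight zero
outside any facet containing that face. -/
theorem mem_stanleyReisnerIdeal_of_forall {f : MvPolynomial σ 𝕃}
    (h : ∀ G, Maximal (· ∈ Δ) G → f ∈ weightIdeal 𝕃 (outsideWeight G) 1) :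
    f ∈ stanleyReisnerIdeal 𝕃 Δ := by
  classical
  have := Fintype.ofFinite σ
  rw [f.as_sum]
  refine Ideal.sum_mem _ fun m hm => ?_
  have hmΔ : m.support ∉ Δ := by
    intro hmem
    obtain ⟨G, hmG, hG⟩ := Δ.toFinite.exists_le_maximal hmem
    have := mem_weightIdeal_iff_forall_support.1 (h G hG) m hm
    rw [weight_outsideWeight_eq_zero_iff.2 hmG] at this
    exact absurd this (by simp)
  rw [monomial_eq]
  refine Ideal.mul_mem_left _ _ (Ideal.mem_of_dvd _ ?_ (prod_X_mem_stanleyReisnerIdeal hmΔ))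
  exact Finset.prod_dvd_prod_of_dvd _ _ fun v hv =>
    dvd_pow_self _ (Finsupp.mem_support_iff.1 hv)

/-- The product over `G` lies in the prime of every other facet, since distinct facets are
incomparable. -/
theorem mul_prod_X_mem_stanleyReisnerIdeal {G : Finset σ}
    (hG : Maximal (· ∈ Δ) G) {f : MvPolynomial σ 𝕃}
    (hf : f ∈ weightIdeal 𝕃 (outsideWeight G) 1) :
    f * ∏ v ∈ G, X v ∈ stanleyReisnerIdeal 𝕃 Δ := by
  refine mem_stanleyReisnerIdeal_of_forall fun G' hG' => ?_
  by_cases h : G = G'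
  · exact h ▸ Ideal.mul_mem_right _ _ hf
  · have := weightIdeal_one_isPrime (𝕃 := 𝕃) (outsideWeight G')
    obtain ⟨v, hv, hvG'⟩ : ∃ v ∈ G, v ∉ G' := by
      by_contra! hc
      exact h (le_antisymm hc (hG.2 hG'.1 hc))
    refine Ideal.mul_mem_left _ _ ((Ideal.IsPrime.prod_mem_iff).2 ⟨v, hv, X_mem_weightIdeal hvG'⟩)

/-- The associated primes of a Stanley-Reisner ring are the primes generated by the complements
of the facets. -/
theorem isAssociatedPrime_stanleyReisnerIdeal_iff (hΔ : IsLowerSet Δ)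
    {P : Ideal (MvPolynomial σ 𝕃)} :
    IsAssociatedPrime P (MvPolynomial σ 𝕃 ⧸ stanleyReisnerIdeal 𝕃 Δ) ↔
      ∃ G, Maximal (· ∈ Δ) G ∧ P = weightIdeal 𝕃 (outsideWeight G) 1 := by
  classical
  rw [isAssociatedPrime_iff]
  have key : ∀ r x : MvPolynomial σ 𝕃,
      r ∈ (⊥ : Submodule (MvPolynomial σ 𝕃) (MvPolynomial σ 𝕃 ⧸ stanleyReisnerIdeal 𝕃 Δ)).colon
        {Ideal.Quotient.mk _ x} ↔ r * x ∈ stanleyReisnerIdeal 𝕃 Δ := by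
    intro r x
    rw [Submodule.mem_colon_singleton, Submodule.mem_bot, ← Ideal.Quotient.eq_zero_iff_mem,
      map_mul]
    rfl
  constructor
  · rintro ⟨hP, x, hx⟩
    obtain ⟨x, rfl⟩ := Ideal.Quotient.mk_surjective x
    have hmem : ∀ r, r ∈ P ↔ r * x ∈ stanleyReisnerIdeal 𝕃 Δ := fun r => by rw [hx, key]
    -- Only facets whose prime misses `x` matter: the intersection of their primes annihilates `x`,
    -- and the prime `P` contains one of them.
    let t : Finset (Finset σ) := (Set.toFinite
      {G | Maximal (· ∈ Δ) G ∧ x ∉ weightIdeal 𝕃 (outsideWeight G) 1}).toFinset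
    have hle : t.inf (fun G => weightIdeal 𝕃 (outsideWeight G) 1) ≤ P := by
      intro r hr
      rw [hmem]
      refine mem_stanleyReisnerIdeal_of_forall fun G hG => ?_
      by_cases hx' : x ∈ weightIdeal 𝕃 (outsideWeight G) 1
      · exact Ideal.mul_mem_left _ _ hx'
      · exact Ideal.mul_mem_right _ _
          (Finset.inf_le (f := fun G => weightIdeal 𝕃 (outsideWeight G) 1)
            ((Set.Finite.mem_toFinset _).2 ⟨hG, hx'⟩ : G ∈ t) hr)
    obtain ⟨G, hGt, hGP⟩ := (Ideal.IsPrime.inf_le' hP).1 hle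
    obtain ⟨hG, hxG⟩ := (Set.Finite.mem_toFinset _).1 hGt
    refine ⟨G, hG, le_antisymm (fun r hr => mem_weightIdeal_of_mul_mem hxG ?_) hGP⟩
    rw [mul_comm]
    exact stanleyReisnerIdeal_le_weightIdeal hΔ hG.1 ((hmem r).1 hr)
  · rintro ⟨G, hG, rfl⟩
    refine ⟨weightIdeal_one_isPrime _, Ideal.Quotient.mk _ (∏ v ∈ G, X v), ?_⟩
    ext r
    rw [key]
    refine ⟨mul_prod_X_mem_stanleyReisnerIdeal hG, fun h => ?_⟩
    refine mem_weightIdeal_of_mul_mem (prod_X_notMem_weightIdeal G) ?_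
    rw [mul_comm]
    exact stanleyReisnerIdeal_le_weightIdeal hΔ hG.1 h

/-- Each of `s` variables outside `G` is paired with one copy of the product over `G`, and every
pair lies in the ideal. -/
theorem monomial_mul_pow_mem {G : Finset σ} (hG : Maximal (· ∈ Δ) G) {s : ℕ}
    {m : σ →₀ ℕ} (c : 𝕃) (hm : s ≤ Finsupp.weight (outsideWeight G) m) :
    monomial m c * (∏ v ∈ G, X v) ^ s ∈ stanleyReisnerIdeal 𝕃 Δ ^ s := by
  induction s generalizing m with
  | zero => simp
  | succ s ih =>
    obtain ⟨v, hv, hvG⟩ : ∃ v ∈ m.support, v ∉ G := by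
      by_contra! h
      rw [weight_outsideWeight_eq_zero_iff.2 h] at hm
      omega
    obtain ⟨m', rfl⟩ : ∃ m', m = m' + Finsupp.single v 1 :=
      ⟨m - Finsupp.single v 1, (tsub_add_cancel_of_le (by
        rw [Finsupp.single_le_iff]
        exact Nat.one_le_iff_ne_zero.2 (Finsupp.mem_support_iff.1 hv))).symm⟩
    have hw : s ≤ Finsupp.weight (outsideWeight G) m' := by
      simpa [Finsupp.weight_single, outsideWeight, hvG] using hm
    have : monomial (m' + Finsupp.single v 1) c * (∏ v ∈ G, X v) ^ (s + 1) =
        (monomial m' c * (∏ v ∈ G, X v) ^ s) * (X v * ∏ v ∈ G, X v) := by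
      rw [monomial_add_single, pow_succ]
      ring
    rw [this, pow_succ]
    exact Ideal.mul_mem_mul (ih hw) (mul_prod_X_mem_stanleyReisnerIdeal hG (X_mem_weightIdeal hvG))

theorem mem_symbolicPower_stanleyReisnerIdeal_iff (hΔ : IsLowerSet Δ) {s : ℕ}
    {f : MvPolynomial σ 𝕃} :
    f ∈ symbolicPower (stanleyReisnerIdeal 𝕃 Δ) s ↔
      ∀ m ∈ f.support, ∀ G, Maximal (· ∈ Δ) G → s ≤ Finsupp.weight (outsideWeight G) m := by
  have hsymb : f ∈ symbolicPower (stanleyReisnerIdeal 𝕃 Δ) s ↔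
      ∀ G, Maximal (· ∈ Δ) G →
        ∃ u ∉ weightIdeal 𝕃 (outsideWeight G) 1, u * f ∈ stanleyReisnerIdeal 𝕃 Δ ^ s := by
    simp only [symbolicPower, Ideal.mem_iInf, Ideal.mem_comap]
    constructor
    · intro h G hG
      have hP := (isAssociatedPrime_stanleyReisnerIdeal_iff (𝕃 := 𝕃) hΔ).2 ⟨G, hG, rfl⟩
      have := hP.isPrime
      exact (IsLocalization.algebraMap_mem_map_algebraMap_iff
        (weightIdeal 𝕃 (outsideWeight G) 1).primeCompl _ _ _).1 (h _ hP)
    · intro h P hP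
      obtain ⟨G, hG, rfl⟩ := (isAssociatedPrime_stanleyReisnerIdeal_iff hΔ).1 hP
      have := hP.isPrime
      exact (IsLocalization.algebraMap_mem_map_algebraMap_iff
        (weightIdeal 𝕃 (outsideWeight G) 1).primeCompl _ _ _).2 (h G hG)
  rw [hsymb]
  constructor
  · intro h m hm G hG
    obtain ⟨u, hu, huf⟩ := h G hG
    have := weightIdeal_one_pow_le _ s
      (Ideal.pow_right_mono (stanleyReisnerIdeal_le_weightIdeal hΔ hG.1) s huf)
    exact mem_weightIdeal_iff_forall_support.1 (mem_weightIdeal_of_mul_mem hu this) m hm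
  · intro h G hG
    have hprime := weightIdeal_one_isPrime (𝕃 := 𝕃) (outsideWeight G)
    refine ⟨(∏ v ∈ G, X v) ^ s,
      fun hu => prod_X_notMem_weightIdeal G (hprime.mem_of_pow_mem _ hu), ?_⟩
    rw [mul_comm, f.as_sum, Finset.sum_mul]
    refine Ideal.sum_mem _ fun m hm => ?_
    exact monomial_mul_pow_mem hG _ (h m hm G hG)

-- Reduces the initial degree to an integer program: in a homogeneous element, any single monomial
-- already satisfies the constraints and has the right degree.
open Classical in
theorem initialDegree_symbolicPower_eq [Fintype σ] (hΔ : IsLowerSet Δ) {s N : ℕ}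
    (hle : ∀ m : σ →₀ ℕ,
      (∀ G, Maximal (· ∈ Δ) G → s ≤ ∑ v ∈ Gᶜ, m v) → N ≤ ∑ v, m v)
    (hex : ∃ m : σ →₀ ℕ, (∀ G, Maximal (· ∈ Δ) G → s ≤ ∑ v ∈ Gᶜ, m v) ∧ ∑ v, m v = N) :
    initialDegree (symbolicPower (stanleyReisnerIdeal 𝕃 Δ) s) = N := by
  have hw (G : Finset σ) (m : σ →₀ ℕ) :
      Finsupp.weight (outsideWeight G) m = ∑ v ∈ Gᶜ, m v := by
    simp [Finsupp.weight_eq_sum, outsideWeight, Finset.sum_ite, Finset.filter_not,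
      Finset.compl_eq_univ_sdiff]
  have hN : N ∈ {d : ℕ | ∃ f ∈ symbolicPower (stanleyReisnerIdeal 𝕃 Δ) s,
      f ≠ 0 ∧ f.IsHomogeneous d} := by
    obtain ⟨m, hm, rfl⟩ := hex
    refine ⟨monomial m 1, ?_, by simp, isHomogeneous_monomial _ (m.degree_eq_sum)⟩
    rw [mem_symbolicPower_stanleyReisnerIdeal_iff hΔ]
    intro m' hm' G hG
    rw [support_monomial, if_neg one_ne_zero, Finset.mem_singleton] at hm'
    rw [hm', hw]
    exact hm G hG
  refine le_antisymm (Nat.sInf_le hN) (le_csInf ⟨N, hN⟩ ?_)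
  rintro d ⟨f, hf, hf0, hfd⟩
  obtain ⟨m, hm⟩ := support_nonempty.2 hf0
  have hdeg : m.degree = d := by
    rw [Finsupp.degree_eq_weight_one]
    exact hfd (mem_support_iff.1 hm)
  rw [← hdeg, Finsupp.degree_eq_sum]
  refine hle m fun G hG => ?_
  rw [← hw]
  exact (mem_symbolicPower_stanleyReisnerIdeal_iff hΔ).1 hf m hm G hG

end StanleyReisner

/-! ### Arithmetic of extended subadditive sequences. -/

section Sequence

variable {d : ℕ → ℕ} {D : ℕ}

theorem ExtendedSubadditive.quotient_add_le (hd : ExtendedSubadditive d D) (h0 : d 0 = 0)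
    (hD : 0 < D) (s : ℕ) {i : ℕ} (hi : i ≤ D) :
    d D * ((s + i) / D) + d ((s + i) % D) ≤ d D * (s / D) + d (s % D) + d i := by
  obtain ⟨q, r, hr, rfl⟩ : ∃ q r, r < D ∧ s = r + D * q :=
    ⟨s / D, s % D, Nat.mod_lt _ hD, (Nat.mod_add_div s D).symm⟩
  have hdiv (q r : ℕ) (hr : r < D) : (r + D * q) / D = q := by
    rw [Nat.add_mul_div_left _ _ hD, Nat.div_eq_of_lt hr, zero_add]
  have hmod (q r : ℕ) (hr : r < D) : (r + D * q) % D = r := by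
    rw [Nat.add_mul_mod_self_left, Nat.mod_eq_of_lt hr]
  rw [hdiv q r hr, hmod q r hr]
  rcases Nat.eq_zero_or_pos i with rfl | hi0
  · rw [add_zero, hdiv q r hr, hmod q r hr]
    omega
  rcases lt_or_ge (r + i) D with hlt | hge
  · rw [show r + D * q + i = (r + i) + D * q by ring, hdiv q _ hlt, hmod q _ hlt]
    rcases Nat.eq_zero_or_pos r with rfl | hr0
    · rw [zero_add]
      omega
    · have := hd.1 r i hr0 hi0 hlt.le
      omega
  · obtain ⟨t, ht⟩ := Nat.exists_eq_add_of_le hge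
    have htD : t < D := by omega
    rw [show r + D * q + i = t + D * (q + 1) by rw [mul_add]; omega, hdiv _ _ htD, hmod _ _ htD,
      mul_add, mul_one]
    rcases Nat.eq_zero_or_pos t with rfl | ht0
    · rcases Nat.eq_zero_or_pos r with rfl | hr0
      · obtain rfl : i = D := by omega
        omega
      · have := hd.1 r i hr0 hi0 (by omega)
        rw [ht, add_zero] at this
        omega
    · rcases hi.eq_or_lt with rfl | hiD
      · obtain rfl : t = r := by omega
        omega
      -- With a carry, $r+i=D+t$, and the second inequality reads $d_t+d_D\le d_i+d_r$.
      · have := hd.2 t i ht0 (by omega) hi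
        rw [show D + t - i = r by omega] at this
        omega

theorem ExtendedSubadditive.quotient_sum_le (hd : ExtendedSubadditive d D) (h0 : d 0 = 0)
    (hD : 0 < D) {ι : Type*} (t : Finset ι) {i : ι → ℕ} (hi : ∀ j ∈ t, i j ≤ D) :
    d D * ((∑ j ∈ t, i j) / D) + d ((∑ j ∈ t, i j) % D) ≤ ∑ j ∈ t, d (i j) := by
  classical
  induction t using Finset.induction_on with
  | empty => simp [h0]
  | insert a t ha ih =>
    rw [Finset.sum_insert ha, Finset.sum_insert ha, add_comm (i a), add_comm (d (i a))]
    exact (hd.quotient_add_le h0 hD _ (hi a (Finset.mem_insert_self _ _))).trans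
      (Nat.add_le_add_right (ih fun j hj => hi j (Finset.mem_insert_of_mem hj)) _)

theorem quotient_mono (hmono : ∀ i j, i ≤ j → j ≤ D → d i ≤ d j) (hD : 0 < D) :
    Monotone fun s => d D * (s / D) + d (s % D) := by
  refine monotone_nat_of_le_succ fun s => ?_
  have hlt := Nat.mod_lt s hD
  by_cases h : D ∣ s + 1
  · have hmod : (s + 1) % D = 0 := Nat.mod_eq_zero_of_dvd h
    have := hmono (s % D) D hlt.le le_rfl
    rw [hmod, Nat.succ_div_of_dvd h, mul_add]
    omega
  · rw [Nat.succ_div_of_not_dvd h]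
    refine Nat.add_le_add_left (hmono _ _ ?_ (Nat.mod_lt _ hD).le) _
    have h1 := Nat.mod_add_div s D
    have h2 := Nat.mod_add_div (s + 1) D
    rw [Nat.succ_div_of_not_dvd h] at h2
    omega

theorem tendsto_quotient_div (hD : 0 < D) {a : ℕ → ℕ} {n : ℕ} (hd : ∀ r < D, d r ≤ n)
    (ha : ∀ s, a s = n * (s / D) + d (s % D)) :
    Tendsto (fun s : ℕ => (a s : ℝ) / (s : ℝ)) atTop (𝓝 ((n : ℝ) / D)) := by
  have hD' : (0 : ℝ) < D := by exact_mod_cast hD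
  rw [tendsto_iff_norm_sub_tendsto_zero]
  refine squeeze_zero' (Eventually.of_forall fun _ => norm_nonneg _) ?_
    (tendsto_const_div_atTop_nhds_zero_nat (n : ℝ))
  filter_upwards [eventually_gt_atTop 0] with s hs
  have hs' : (0 : ℝ) < s := by exact_mod_cast hs
  have hr := Nat.mod_lt s hD
  have hsplit : (s : ℝ) = (s % D : ℕ) + D * (s / D : ℕ) := by
    exact_mod_cast (Nat.mod_add_div s D).symm
  have hnum : (a s : ℝ) / s - n / D = (d (s % D) - n * ((s % D : ℕ) / D : ℝ)) / s := by
    rw [ha, Nat.cast_add, Nat.cast_mul]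
    have h : ((s / D : ℕ) : ℝ) = (s - (s % D : ℕ)) / D := by
      rw [eq_div_iff hD'.ne']; linarith
    rw [h]
    field_simp
    ring
  have h1 : (d (s % D) : ℝ) ≤ n := by exact_mod_cast hd _ hr
  have h2 : ((s % D : ℕ) / D : ℝ) ≤ 1 := by
    rw [div_le_one hD']
    exact_mod_cast hr.le
  have h3 : (0 : ℝ) ≤ ((s % D : ℕ) / D : ℝ) := by positivity
  have h4 : (n : ℝ) * ((s % D : ℕ) / D : ℝ) ≤ n := mul_le_of_le_one_right (by positivity) h2
  have h5 : (0 : ℝ) ≤ (n : ℝ) * ((s % D : ℕ) / D : ℝ) := by positivity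
  have h6 : (0 : ℝ) ≤ d (s % D) := by positivity
  rw [hnum, Real.norm_eq_abs, abs_div, abs_of_pos hs']
  gcongr
  rw [abs_le]
  constructor <;> linarith

end Sequence

/-! ### Bases adapted to chains, and generalized Hamming weights. -/

namespace Matroid

variable {α : Type*}

/-- The greedy construction: extending the basis to the next set cannot enlarge its trace on an
earlier one, where it is already maximal independent. -/
theorem exists_isBasis_forall_isBasis_inter (M : Matroid α) {A : ℕ → Set α} (hA : Monotone A)
    (hAE : ∀ j, A j ⊆ M.E) (n : ℕ) :
    ∃ I, M.IsBasis I (A n) ∧ ∀ j ≤ n, M.IsBasis (A j ∩ I) (A j) := by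
  induction n with
  | zero =>
    obtain ⟨I, hI⟩ := M.exists_isBasis (A 0) (hAE 0)
    refine ⟨I, hI, fun j hj => ?_⟩
    obtain rfl : j = 0 := by omega
    rwa [Set.inter_eq_self_of_subset_right hI.subset]
  | succ n ih =>
    obtain ⟨I, hI, hIA⟩ := ih
    obtain ⟨J, hJ, hIJ⟩ := hI.indep.subset_isBasis_of_subset
      (hI.subset.trans (hA n.le_succ)) (hAE _)
    refine ⟨J, hJ, fun j hj => ?_⟩
    rcases hj.eq_or_lt with rfl | hlt
    · rwa [Set.inter_eq_self_of_subset_right hJ.subset]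
    · have hjI := hIA j (by omega)
      have : A j ∩ I = A j ∩ J := hjI.eq_of_subset_indep (hJ.indep.inter_left _)
        (Set.inter_subset_inter_right _ hIJ) Set.inter_subset_left
      rwa [← this]

theorem IsPaving.eRank_le_encard {M : Matroid α} (hM : M.IsPaving) {A : Set α} (hA : M.Dep A) :
    M.eRank ≤ A.encard := by
  obtain ⟨C, hCA, hC⟩ := hA.exists_isCircuit_subset
  refine le_trans ?_ (Set.encard_le_encard hCA)
  rcases hM C hC with h | h <;> rw [h]
  exact le_self_add

variable (M : Matroid α) [M.Finite]

theorem hammingWeight_zero : M.hammingWeight 0 = 0 := rfl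

/-- Together with `exists_ncard_eq_hammingWeight`, this replaces circuits of elongations by sets of
nullity at least `i`. -/
theorem hammingWeight_le_ncard {i : ℕ} {A : Set α} (hA : A ⊆ M.E)
    (h : M.eRk A + i ≤ A.encard) : M.hammingWeight i ≤ A.ncard := by
  cases i with
  | zero => exact Nat.zero_le _
  | succ i =>
    have hfin := M.ground_finite.subset hA
    have hdep : (M.elongation i).Dep A := by
      refine (not_indep_iff (M := M.elongation i) hA).1 fun hind => ?_
      have hlt := h.trans ((elongation_indep_iff M i A).1 hind).2
      obtain ⟨c, hc⟩ := ENat.ne_top_iff_exists.1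
        (ne_top_of_le_ne_top (Set.encard_ne_top_iff.2 hfin) (M.eRk_le_encard A))
      rw [← hc] at hlt
      norm_cast at hlt
      omega
    obtain ⟨C, hCA, hC⟩ := hdep.exists_isCircuit_subset
    have hle : M.hammingWeight (i + 1) ≤ C.ncard := Nat.sInf_le ⟨C, hC, rfl⟩
    exact hle.trans (Set.ncard_le_ncard hCA hfin)

theorem exists_ncard_eq_hammingWeight {i : ℕ} (hi : M.eRank + i ≤ M.E.encard) :
    ∃ A ⊆ M.E, M.eRk A + i ≤ A.encard ∧ A.ncard = M.hammingWeight i := by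
  cases i with
  | zero => exact ⟨∅, Set.empty_subset _, by simp, by simp [hammingWeight_zero]⟩
  | succ i =>
    have hdep (A : Set α) (hA : (M.elongation i).Dep A) : M.eRk A + (i + 1 : ℕ) ≤ A.encard := by
      have := hA.not_indep
      rw [elongation_indep_iff, not_and, not_le] at this
      have := this hA.subset_ground
      rw [Nat.cast_add, ← add_assoc]
      exact Order.add_one_le_of_lt this
    have hE : (M.elongation i).Dep M.E := by
      refine (not_indep_iff (M := M.elongation i) subset_rfl).1 fun hind => ?_
      have hlt := hi.trans ((elongation_indep_iff M i M.E).1 hind).2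
      rw [eRk_ground] at hlt
      obtain ⟨c, hc⟩ := ENat.ne_top_iff_exists.1
        (ne_top_of_le_ne_top (Set.encard_ne_top_iff.2 M.ground_finite) M.eRank_le_encard_ground)
      rw [← hc] at hlt
      norm_cast at hlt
      omega
    obtain ⟨C, -, hC⟩ := hE.exists_isCircuit_subset
    obtain ⟨C, hC, hCd⟩ := Nat.sInf_mem
      (s := {m : ℕ | ∃ C : Set α, (M.elongation i).IsCircuit C ∧ C.ncard = m}) ⟨_, C, hC, rfl⟩
    exact ⟨C, hC.subset_ground, hdep C hC.dep, hCd⟩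

theorem hammingWeight_mono {i j : ℕ} (hij : i ≤ j) (hj : M.eRank + j ≤ M.E.encard) :
    M.hammingWeight i ≤ M.hammingWeight j := by
  obtain ⟨A, hA, hAj, hAd⟩ := M.exists_ncard_eq_hammingWeight hj
  rw [← hAd]
  exact M.hammingWeight_le_ncard hA (le_trans (by gcongr) hAj)

/-! ### Weights when the dual is paving. -/

section Paving

variable {M} {n k : ℕ}

/-- The complement of `A` has fewer elements than the rank of `M✶`, too few to contain a circuit of
`M✶`. -/
theorem IsPaving.eRk_eq_of_lt_ncard (hM : M✶.IsPaving) (hk : M.eRank = k) {A : Set α}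
    (hA : A ⊆ M.E) (hkA : k < A.ncard) : M.eRk A = k := by
  have hdual : M.eRank + M✶.eRank = M.E.encard := M.eRank_add_eRank_dual
  have hcoindep : M.Coindep (M.E \ A) := by
    rw [coindep_def]
    by_contra hdep
    have hle := hM.eRank_le_encard ((not_indep_iff (M := M✶) (X := M.E \ A) Set.sdiff_subset).1 hdep)
    rw [hk, ← Set.encard_sdiff_add_encard_of_subset hA,
      ← (M.ground_finite.subset hA).cast_ncard_eq] at hdual
    rw [← (M.ground_finite.subset (Set.sdiff_subset (s := M.E) (t := A))).cast_ncard_eq]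
      at hdual hle
    obtain ⟨c, hc⟩ := ENat.ne_top_iff_exists.1 (ne_top_of_le_ne_top (ENat.natCast_ne_top _) hle)
    rw [← hc] at hdual hle
    norm_cast at hdual hle
    omega
  have := hcoindep.compl_spanning
  rw [Set.sdiff_sdiff_cancel_left hA] at this
  rw [this.eRk_eq, hk]

theorem hammingWeight_le_add (hn : M.E.ncard = n) (hk : M.eRank = k) {i : ℕ} (hi : k + i ≤ n) :
    M.hammingWeight i ≤ k + i := by
  obtain ⟨A, hA, hAc⟩ := Set.exists_subset_card_eq (hn ▸ hi)
  rw [← hAc]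
  refine M.hammingWeight_le_ncard hA ?_
  rw [← (M.ground_finite.subset hA).cast_ncard_eq, hAc, Nat.cast_add, ← hk]
  gcongr
  exact M.eRk_le_eRank A

theorem IsPaving.hammingWeight_eq (hM : M✶.IsPaving) (hn : M.E.ncard = n) (hk : M.eRank = k)
    {i : ℕ} (hi : 2 ≤ i) (hin : k + i ≤ n) : M.hammingWeight i = k + i := by
  refine le_antisymm (hammingWeight_le_add hn hk hin) ?_
  have hE : M.eRank + i ≤ M.E.encard := by
    rw [hk, ← M.ground_finite.cast_ncard_eq, hn]
    exact_mod_cast hin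
  obtain ⟨A, hA, hAi, hAc⟩ := M.exists_ncard_eq_hammingWeight hE
  rw [← hAc]
  rw [← (M.ground_finite.subset hA).cast_ncard_eq] at hAi
  rcases lt_or_ge k A.ncard with hlt | hge
  · rw [hM.eRk_eq_of_lt_ncard hk hA hlt] at hAi
    exact_mod_cast hAi
  -- A superset of `A` with `k + 1` elements has rank `k`, hence nullity 1; nullity is monotone,
  -- contradicting `2 ≤ i`.
  · exfalso
    obtain ⟨A', hAA', hA'E, hA'c⟩ := Set.exists_subsuperset_card_eq hA
      (show A.ncard ≤ k + 1 by omega) (show k + 1 ≤ M.E.ncard by omega)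
    have h1 := hM.eRk_eq_of_lt_ncard hk hA'E (by omega)
    have h2 := (M.eRk_le_eRk_add_eRk_sdiff hAA').trans
      (add_le_add_right (M.eRk_le_encard (A' \ A)) _)
    have hfin' := M.ground_finite.subset hA'E
    have h3 := Set.ncard_sdiff_add_ncard_of_subset hAA' hfin'
    rw [h1, ← (hfin'.subset Set.sdiff_subset).cast_ncard_eq] at h2
    obtain ⟨c, hc⟩ := ENat.ne_top_iff_exists.1
      (ne_top_of_le_ne_top (ENat.natCast_ne_top _) (le_self_add.trans hAi))
    rw [← hc] at hAi h2
    norm_cast at hAi h2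
    omega

theorem IsPaving.le_hammingWeight_one (hM : M.IsPaving) (hn : M.E.ncard = n) (hk : M.eRank = k)
    (hkn : k < n) : k ≤ M.hammingWeight 1 := by
  have hE : M.eRank + (1 : ℕ) ≤ M.E.encard := by
    rw [hk, ← M.ground_finite.cast_ncard_eq, hn]
    exact_mod_cast hkn
  obtain ⟨A, hA, hAi, hAc⟩ := M.exists_ncard_eq_hammingWeight hE
  have hfin := M.ground_finite.subset hA
  have hdep : M.Dep A := by
    refine (not_indep_iff hA).1 fun hind => ?_
    rw [hind.eRk_eq_encard, ← hfin.cast_ncard_eq] at hAi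
    norm_cast at hAi
    omega
  have := hM.eRank_le_encard hdep
  rw [hk, ← hfin.cast_ncard_eq, hAc] at this
  exact_mod_cast this

theorem IsPaving.extendedSubadditive (hM : M✶.IsPaving) (hn : M.E.ncard = n) (hk : M.eRank = k)
    (hkn : k + 2 ≤ n) (h1 : k + 2 ≤ 2 * M.hammingWeight 1) :
    ExtendedSubadditive M.hammingWeight (n - k) := by
  have hle : M.hammingWeight 1 ≤ k + 1 := hammingWeight_le_add hn hk (by omega)
  have heq (i : ℕ) (hi : 1 ≤ i) (hin : i ≤ n - k) : i = 1 ∨ M.hammingWeight i = k + i := by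
    rcases hi.eq_or_lt with rfl | hi
    · exact .inl rfl
    · exact .inr (hM.hammingWeight_eq hn hk hi (by omega))
  refine ⟨fun i j hi hj hij => ?_, fun r t hr hrt ht => ?_⟩
  · rw [hM.hammingWeight_eq hn hk (by omega : 2 ≤ i + j) (by omega)]
    -- The tight case is `i = j = 1`, which is exactly `h1`.
    rcases heq i hi (by omega) with rfl | h <;> rcases heq j hj (by omega) with rfl | h' <;> omega
  · rw [hM.hammingWeight_eq hn hk (by omega : 2 ≤ t) (by omega),
      hM.hammingWeight_eq hn hk (by omega : 2 ≤ n - k) (by omega)]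
    rcases hr.eq_or_lt with rfl | hr
    · rcases heq (n - k + 1 - t) (by omega) (by omega) with h' | h'
      · rw [h']; omega
      · omega
    · rw [hM.hammingWeight_eq hn hk (by omega : 2 ≤ r) (by omega),
        hM.hammingWeight_eq hn hk (by omega : 2 ≤ n - k + r - t) (by omega)]
      omega

end Paving

end Matroid

/-! ### The integer program over the bases of the matroid. -/

namespace Matroid

variable {α : Type*}

theorem encard_image_coe {E : Set α} (S : Finset E) :
    ((fun e : E => (e : α)) '' (S : Set E)).encard = S.card := by
  rw [Subtype.val_injective.encard_image, Set.encard_coe_eq_coe_finsetCard]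

theorem isLowerSet_independenceComplex (M : Matroid α) : IsLowerSet M.independenceComplex := by
  intro F G hGF hF
  exact Indep.subset hF (Set.image_mono hGF)

theorem maximal_mem_independenceComplex_iff (M : Matroid α) {G : Finset M.E} :
    Maximal (· ∈ M.independenceComplex) G ↔
      M.IsBase ((fun e : M.E => (e : α)) '' (G : Set M.E)) := by
  classical
  constructor
  · intro h
    have hG : M.Indep ((fun e : M.E => (e : α)) '' (G : Set M.E)) := h.1
    refine hG.isBase_of_forall_insert fun e he hind => he.2 ?_
    have hmem : insert ⟨e, he.1⟩ G ∈ M.independenceComplex := by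
      have : (fun e : M.E => (e : α)) '' ((insert ⟨e, he.1⟩ G : Finset M.E) : Set M.E) =
          insert e ((fun e : M.E => (e : α)) '' (G : Set M.E)) := by
        rw [Finset.coe_insert, Set.image_insert_eq]
      rw [independenceComplex, Set.mem_ofPred_eq, this]
      exact hind
    exact ⟨⟨e, he.1⟩, h.2 hmem (Finset.subset_insert _ _) (Finset.mem_insert_self _ _), rfl⟩
  · intro h
    refine ⟨h.indep, fun F hF hGF => ?_⟩
    have hF' : M.Indep ((fun e : M.E => (e : α)) '' (F : Set M.E)) := hF
    have := h.eq_of_subset_indep hF' (Set.image_mono hGF)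
    exact Finset.coe_subset.1 ((Set.image_injective.2 Subtype.val_injective) this).ge

theorem card_of_maximal_mem_independenceComplex (M : Matroid α) {k : ℕ} (hk : M.eRank = k)
    {G : Finset M.E} (hG : Maximal (· ∈ M.independenceComplex) G) : G.card = k := by
  have := (M.maximal_mem_independenceComplex_iff.1 hG).encard_eq_eRank
  rw [encard_image_coe, hk] at this
  exact_mod_cast this

variable (M : Matroid α) [M.Finite] [Fintype M.E] [DecidableEq M.E] {n k : ℕ}

theorem quotient_le_sum_of_forall_le_sum_compl (hn : M.E.ncard = n) (hk : M.eRank = k)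
    (hkn : k < n) (hd : ExtendedSubadditive M.hammingWeight (n - k)) (s : ℕ) (m : M.E → ℕ)
    (h : ∀ G, Maximal (· ∈ M.independenceComplex) G → s ≤ ∑ v ∈ Gᶜ, m v) :
    M.hammingWeight (n - k) * (s / (n - k)) + M.hammingWeight (s % (n - k)) ≤ ∑ v, m v := by
  classical
  set N := ∑ v, m v with hN
  have hmN (v : M.E) : m v ≤ N := Finset.single_le_sum (fun _ _ => Nat.zero_le _) (Finset.mem_univ v)
  -- Superlevel sets of `m` at height `N - j`, indexed so that they increase with `j` and exhaust
  -- the ground set at `j = N`.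
  let T (j : ℕ) : Finset M.E := Finset.univ.filter fun v => N ≤ m v + j
  let A (j : ℕ) : Set α := (fun e : M.E => (e : α)) '' (T j : Set M.E)
  have hA : Monotone A := fun i j hij => Set.image_mono fun v hv => by
    simp only [T, Finset.coe_filter, Finset.mem_univ, true_and, Set.mem_ofPred_eq] at hv ⊢
    omega
  have hAE (j : ℕ) : A j ⊆ M.E := by
    rintro _ ⟨v, -, rfl⟩
    exact v.2
  have hAN : A N = M.E := by
    have : T N = Finset.univ := Finset.filter_true_of_mem fun v _ => Nat.le_add_left _ _
    simp [A, this]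
  obtain ⟨B, hB, hBA⟩ := M.exists_isBasis_forall_isBasis_inter hA hAE N
  rw [hAN, isBasis_ground_iff] at hB
  let G : Finset M.E := Finset.univ.filter fun v => (v : α) ∈ B
  have hGB : (fun e : M.E => (e : α)) '' (G : Set M.E) = B := by
    ext e
    simpa [G] using fun he => hB.subset_ground he
  have hG : Maximal (· ∈ M.independenceComplex) G :=
    M.maximal_mem_independenceComplex_iff.2 (by rwa [hGB])
  -- Layer-cake summation: `v` lies in `T j` for exactly `m v` of the indices `j < N`.
  have hsum (S : Finset M.E) : ∑ v ∈ S, m v = ∑ j ∈ Finset.range N, (S ∩ T j).card := by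
    have hm (v : M.E) : m v = ∑ j ∈ Finset.range N, if N ≤ m v + j then 1 else 0 := by
      rw [← Finset.card_filter]
      have : (Finset.range N).filter (fun j => N ≤ m v + j) = Finset.Ico (N - m v) N := by
        ext j
        simp only [Finset.mem_filter, Finset.mem_range, Finset.mem_Ico]
        omega
      rw [this, Nat.card_Ico]
      have := hmN v
      omega
    rw [Finset.sum_congr rfl fun v _ => hm v, Finset.sum_comm]
    refine Finset.sum_congr rfl fun j _ => ?_
    rw [← Finset.card_filter]
    congr 1
    ext v
    simp [T]
  have hGk := M.card_of_maximal_mem_independenceComplex hk hG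
  have hEn : Fintype.card M.E = n := by
    rw [← hn, ← Nat.card_coe_set_eq, Nat.card_eq_fintype_card]
  have hi (j : ℕ) : (Gᶜ ∩ T j).card ≤ n - k := by
    refine (Finset.card_le_card Finset.inter_subset_left).trans ?_
    rw [Finset.card_compl, hEn, hGk]
  -- As `B` meets `A j` in a basis, the part of `T j` outside `G` counts the nullity of `A j`.
  have hweight (j : ℕ) (hj : j ∈ Finset.range N) :
      M.hammingWeight (Gᶜ ∩ T j).card ≤ (Finset.univ ∩ T j).card := by
    have hT : (A j).ncard = (Finset.univ ∩ T j).card := by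
      rw [Finset.univ_inter, Set.ncard_image_of_injective _ Subtype.val_injective,
        Set.ncard_coe_finset]
    rw [← hT]
    refine M.hammingWeight_le_ncard (hAE j) ?_
    have hAB : A j ∩ B = (fun e : M.E => (e : α)) '' ((T j ∩ G : Finset M.E) : Set M.E) := by
      rw [Finset.coe_inter, Set.image_inter Subtype.val_injective, hGB]
    rw [(hBA j (Finset.mem_range.1 hj).le).eRk_eq_encard, hAB, encard_image_coe, encard_image_coe]
    norm_cast
    rw [← Finset.card_inter_add_card_sdiff (T j) G, Finset.inter_comm Gᶜ,
      ← Finset.sdiff_eq_inter_compl]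
  have hmono : ∀ i j, i ≤ j → j ≤ n - k → M.hammingWeight i ≤ M.hammingWeight j := by
    intro i j hij hj
    refine M.hammingWeight_mono hij ?_
    rw [hk, ← M.ground_finite.cast_ncard_eq, hn]
    norm_cast
    omega
  have hD : 0 < n - k := by omega
  calc _ ≤ _ := quotient_mono hmono hD ((h G hG).trans_eq (hsum _))
    _ ≤ ∑ j ∈ Finset.range N, M.hammingWeight (Gᶜ ∩ T j).card :=
      hd.quotient_sum_le M.hammingWeight_zero hD _ fun j _ => hi j
    _ ≤ ∑ j ∈ Finset.range N, (Finset.univ ∩ T j).card := Finset.sum_le_sum hweight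
    _ = N := (hsum Finset.univ).symm

/-- A cobase has `n - k` elements, and any base misses at least `r` elements of a set of nullity at
least `r`. -/
theorem exists_forall_le_sum_compl (hn : M.E.ncard = n) (hk : M.eRank = k) {r : ℕ}
    (hr : k + r ≤ n) (q : ℕ) :
    ∃ m : M.E →₀ ℕ, (∀ G, Maximal (· ∈ M.independenceComplex) G →
      (n - k) * q + r ≤ ∑ v ∈ Gᶜ, m v) ∧ ∑ v, m v = n * q + M.hammingWeight r := by
  classical
  have hEn : Fintype.card M.E = n := by
    rw [← hn, ← Nat.card_coe_set_eq, Nat.card_eq_fintype_card]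
  obtain ⟨A, hA, hAr, hAc⟩ := M.exists_ncard_eq_hammingWeight (i := r) (by
    rw [hk, ← M.ground_finite.cast_ncard_eq, hn]
    exact_mod_cast hr)
  let T : Finset M.E := Finset.univ.filter fun v => (v : α) ∈ A
  have hTA : (fun e : M.E => (e : α)) '' (T : Set M.E) = A := by
    ext e
    simpa [T] using fun he => hA he
  have hTc : T.card = M.hammingWeight r := by
    rw [← hAc, ← hTA, Set.ncard_image_of_injective _ Subtype.val_injective, Set.ncard_coe_finset]
  have hsum (S : Finset M.E) :
      ∑ v ∈ S, (q + if v ∈ T then 1 else 0) = S.card * q + (S ∩ T).card := by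
    rw [Finset.sum_add_distrib, Finset.sum_const, smul_eq_mul, Finset.sum_boole,
      Finset.filter_mem_eq_inter, Nat.cast_id]
  refine ⟨Finsupp.equivFunOnFinite.symm fun v => q + if v ∈ T then 1 else 0,
    fun G hG => ?_, ?_⟩
  · simp only [Finsupp.equivFunOnFinite_symm_apply_apply]
    have hB := M.maximal_mem_independenceComplex_iff.1 hG
    have hGk := M.card_of_maximal_mem_independenceComplex hk hG
    have hind : (T ∩ G).card + r ≤ T.card := by
      have h1 : ((T ∩ G).card : ℕ∞) ≤ M.eRk A := by
        rw [← encard_image_coe, Finset.coe_inter, Set.image_inter Subtype.val_injective, hTA]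
        exact (hB.indep.inter_left A).encard_le_eRk_of_subset Set.inter_subset_left
      have h2 := (add_le_add_left h1 (r : ℕ∞)).trans hAr
      rw [← hTA, encard_image_coe] at h2
      exact_mod_cast h2
    rw [hsum, Finset.card_compl, hEn, hGk, Finset.inter_comm, ← Finset.sdiff_eq_inter_compl]
    have := Finset.card_inter_add_card_sdiff T G
    omega
  · simp only [Finsupp.equivFunOnFinite_symm_apply_apply]
    rw [hsum, Finset.card_univ, hEn, Finset.univ_inter, hTc]

end Matroid

theorem mainTheorem10 {α : Type*} (M : Matroid α) [M.Finite] (𝕃 : Type*) [Field 𝕃]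
    (n k : ℕ) (hn : M.E.ncard = n) (hk : M.eRank = (k : ℕ∞)) (hkn : k + 2 ≤ n)
    (hM : (M.IsSparsePaving ∧ 2 ≤ k) ∨
      (M✶.IsPaving ∧ ((k : ℝ) + 2) / 2 ≤ (M.hammingWeight 1 : ℝ))) :
    ExtendedSubadditive M.hammingWeight (n - k) ∧
    (∀ s q r : ℕ, s = (n - k) * q + r → r < n - k →
      initialDegree (symbolicPower (stanleyReisnerIdeal 𝕃 M.independenceComplex) s) =
          q * M.hammingWeight (n - k) + M.hammingWeight r ∧
      initialDegree (symbolicPower (stanleyReisnerIdeal 𝕃 M.independenceComplex) s) =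
          n * q + M.hammingWeight r) ∧
    Tendsto (fun s : ℕ =>
        (initialDegree (symbolicPower (stanleyReisnerIdeal 𝕃 M.independenceComplex) s) : ℝ) /
          (s : ℝ)) atTop
      (𝓝 (waldschmidtConstant (stanleyReisnerIdeal 𝕃 M.independenceComplex))) ∧
    waldschmidtConstant (stanleyReisnerIdeal 𝕃 M.independenceComplex) =
      (M.hammingWeight (n - k) : ℝ) / ((n : ℝ) - (k : ℝ)) ∧
    waldschmidtConstant (stanleyReisnerIdeal 𝕃 M.independenceComplex) =
      (n : ℝ) / ((n : ℝ) - (k : ℝ)) := by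
  classical
  have := M.ground_finite.fintype
  have hpav : M✶.IsPaving := hM.elim (fun h => h.1.2) (fun h => h.1)
  have h1 : k + 2 ≤ 2 * M.hammingWeight 1 := by
    -- For sparse paving `M`, $d_1\ge k$, and $2k\ge k+2$ because $k\ge2$.
    rcases hM with ⟨h, h2⟩ | ⟨-, h⟩
    · have := h.1.le_hammingWeight_one hn hk (by omega)
      omega
    · rw [div_le_iff₀ two_pos] at h
      have h' : k + 2 ≤ M.hammingWeight 1 * 2 := by exact_mod_cast h
      omega
  have hsub := hpav.extendedSubadditive hn hk hkn h1
  have hD : 0 < n - k := by omega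
  have hdD : M.hammingWeight (n - k) = n := by
    rw [hpav.hammingWeight_eq hn hk (by omega) (by omega)]
    omega
  have hα (s : ℕ) :
      initialDegree (symbolicPower (stanleyReisnerIdeal 𝕃 M.independenceComplex) s) =
        n * (s / (n - k)) + M.hammingWeight (s % (n - k)) := by
    have hmod := Nat.mod_lt s hD
    refine initialDegree_symbolicPower_eq M.isLowerSet_independenceComplex (fun m hm => ?_) ?_
    · have := M.quotient_le_sum_of_forall_le_sum_compl hn hk (by omega) hsub s m
        (by convert hm)
      rwa [hdD] at this
    · obtain ⟨m, hm, hms⟩ := M.exists_forall_le_sum_compl hn hk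
        (r := s % (n - k)) (by omega) (s / (n - k))
      rw [Nat.div_add_mod] at hm
      exact ⟨m, by convert hm, hms⟩
  have hlim := tendsto_quotient_div (d := M.hammingWeight) hD (n := n) (fun r hr => by
      refine (M.hammingWeight_mono hr.le ?_).trans_eq hdD
      rw [hk, ← M.ground_finite.cast_ncard_eq, hn]
      norm_cast
      omega) hα
  rw [Nat.cast_sub (by omega)] at hlim
  have hW : waldschmidtConstant (stanleyReisnerIdeal 𝕃 M.independenceComplex) =
      (n : ℝ) / ((n : ℝ) - (k : ℝ)) := hlim.limUnder_eq
  refine ⟨hsub, ?_, by rwa [hW], by rw [hW, hdD], hW⟩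
  rintro s q r rfl hr
  rw [hα, hdD, Nat.mul_add_div hD, Nat.div_eq_of_lt hr, Nat.mul_add_mod, Nat.mod_eq_of_lt hr,
    add_zero]
  exact ⟨by rw [mul_comm], rfl⟩
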